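/- **Games.** Consider a finite extensive-form game with a nonempty finite set of players $N$, possibly with nature $c$, imperfect information, simultaneous moves, and perfect recall. It consists of: a finite set $H$ of finite sequences of action profiles (histories) that contains the empty sequence and all subhistories of its members, with set of terminal histories $Z$; for each $h\in H\setminus Z$ a nonempty set $P(h)\subseteq N\cup\{c\}$ of movers and a nonempty set $A_i(h)$ of actions for each $i\in P(h)$, the successors of $h$ being exactly the $(h,a)$ with $a\in\prod_{i\in P(h)}A_i(h)$; for each $i\in N$ a partition $\mathcal I_i$ (information sets) of $\{h\in H\setminus Z: i\in P(h)\}$ such that $A_i(\cdot)$ is constant on each information set; and utilities $u_i:Z\to\mathbb R$, $i\in N$. Nature's information sets are singletons. Perfect recall means that for each $i\in N$ any two histories in the same information set of $i$ pass through the same sequence of information sets of $i$ with the same actions of $i$ taken there. A strategy $s_i\in S_i$ assigns to each information set of $i$ an action available there (this includes $i=c$); $S_{-i}$ is the set of profiles of strategies of all other players including nature; $z(s)\in Z$ is the terminal history reached by the profile $s$, and $Z(S')=\{z(s):s\in S'\}$ for a set $S'$ of strategy profiles. A profile $s$ reaches $I_i\in\mathcal I_i$ if some history in $I_i$ is a subhistory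 of $z(s)$; $s_i$ (resp. $s_{-i}$) reaches $I_i$ if $(s_i,s_{-i})$ does for some $s_{-i}$ (resp. some $s_i$). Let $S_{-i}(I_i)$ be the set of $s_{-i}$ that reach $I_i$. An information set $I_i$ strictly precedes $I_i'$ if some history in $I_i$ is a proper subhistory of one in $I'_i$. **Belief systems.** A belief system of $i\in N$ is a family $\bar\beta_i=(\bar\beta_i(I_i))_{I_i\in\mathcal I_i}$ of probability measures on $S_{-i}$ such that $\bar\beta_i(I_i)(S_{-i}(I_i))=1$, and such that if $I_i$ strictly precedes $I_i'$ and $\bar\beta_i(I_i)(S_{-i}(I'_i))>0$, then $\bar\beta_i(I_i')=\bar\beta_i(I_i)(\,\cdot\mid S_{-i}(I_i'))$. It has full support if the support of $\bar\beta_i(I_i)$ is $S_{-i}(I_i)$ for every $I_i$. A strategy $s_i$ is rational at $I_i$ with $\bar\beta_i$ if either $s_i$ does not reach $I_i$, or no strategy of $i$ that agrees with $s_i$ on all information sets of $i$ strictly preceding $I_i$ yields $i$ a strictly higher expected utility under $\bar\beta_i(I_i)$. **Strong level-$k$ thinking.** Fix a profile of belief systems $\bar\beta^1=(\bar\beta^1_i)_{i\in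 N}$. Let $\bar L^k_c(\bar\beta^1)=S_c$ for nature (which is indifferent among all terminal histories), and write $\bar L^{\ell}_{-i}$ for the product of the sets $\bar L^\ell_j$, $j\ne i$ (including $j=c$). For $i\in N$ put $\bar B^1_i=\{\bar\beta^1_i\}$; for $k\ge2$ let $\bar B_i^k$ be the set of belief systems $\bar\beta_i$ of $i$ such that for every $I_i\in\mathcal I_i$: if $I_i$ is reached by some $s_{-i}\in\bar L^{\ell}_{-i}$ with $1\le\ell<k$, then $\bar\beta_i(I_i)(\bar L_{-i}^{\bar\ell})=1$ for the largest such $\ell=\bar\ell$; otherwise $\bar\beta_i(I_i)=\bar\beta_i^1(I_i)$. For $k\ge1$, $\bar L^k_i(\bar\beta^1)$ is the set of $s_i\in S_i$ for which there is $\bar\beta_i\in\bar B^k_i$ such that $s_i$ is rational at every $I_i\in\mathcal I_i$ with $\bar\beta_i$. Let $\bar L^k(\bar\beta^1)$ be the product of all $\bar L^k_j(\bar\beta^1)$, $j\in N\cup\{c\}$. **Normal-form level-$k$ thinking.** The associated normal form has action sets $S_j$, $j\in N\cup\{c\}$, and utilities $s\mapsto u_i(z(s))$, $i\in N$. Given probability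 measures $\beta^1_i$ on $S_{-i}$, $i\in N$, let $L^k_c(\beta^1)=S_c$; let $L_i^1(\beta^1)$ be the set of $s_i$ maximizing $i$'s expected utility over $S_i$ under $\beta_i^1$, and for $k\ge2$ let $L_i^k(\beta^1)$ be the set of $s_i$ maximizing $i$'s expected utility over $S_i$ under some probability measure $\beta_i$ on $S_{-i}$ with $\beta_i(L_{-i}^{k-1}(\beta^1))=1$. Let $L^k(\beta^1)$ be the product of all $L^k_j(\beta^1)$, $j\in N\cup\{c\}$. The profile $\beta^1$ has full support if each $\beta_i^1$ has support $S_{-i}$, and it is consistent with $\bar\beta^1$ if $\bar\beta^1_i(I_i)=\beta_i^1(\,\cdot\mid S_{-i}(I_i))$ for all $i\in N$ and $I_i\in\mathcal I_i$. **Proposition.** Let $\bar\beta^1$ be a profile of full-support belief systems in such a game and let $\beta^1$ be a profile of full-support beliefs in the associated normal form that is consistent with $\bar\beta^1$. Then for every $k\ge1$, $$Z(\bar L^k(\bar\beta^1))\subseteq Z(L^k(\beta^1)).$$ -/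

import Mathlib

universe u v

/-!
### Profiles and beliefs

`N` is the set of players. `Option N` is `N` together with nature, which is the element `none`;
player `i` is the element `some i`.
-/

/-- Profiles of everybody but player `i` (the opponents of `i`, including nature). -/
abbrev OppProfile {N : Type u} (S : Option N → Type v) (i : N) : Type (max u v) :=
  (j : {j : Option N // j ≠ some i}) → S j

open Classical in
/-- The profile `(sᵢ, s₋ᵢ)`. -/
noncomputable def joinProfile {N : Type u} {S : Option N → Type v} (i : N)
    (x : S (some i)) (t : OppProfile S i) : (j : Option N) → S j :=
  fun j => if h : j = some i then h ▸ x else t ⟨j, h⟩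

/-- The product `L₋ᵢ` of the sets `L j` over all `j` different from `i`. -/
def oppSet {N : Type u} {S : Option N → Type v} (L : (j : Option N) → Set (S j)) (i : N) :
    Set (OppProfile S i) :=
  {t | ∀ j : {j : Option N // j ≠ some i}, t j ∈ L j}

/-- The expectation of `f` under the probability distribution `p` (it is only used on finite
types). -/
noncomputable def expectation {T : Type u} (p : PMF T) (f : T → ℝ) : ℝ :=
  ∑' t, (p t).toReal * f t

/-- `p` assigns probability one to `E`. -/
def CertainOf {T : Type u} (p : PMF T) (E : Set T) : Prop :=
  p.toOuterMeasure E = 1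

/-- `q` is `p` conditional on `E`, whenever `p` gives positive probability to `E`. -/
def DerivedByConditioning {T : Type u} (p q : PMF T) (E : Set T) : Prop :=
  ∀ h : ∃ t ∈ E, t ∈ p.support, q = p.filter E h

/-! ### Games in normal form and level-`k` thinking -/

/-- A finite game in normal form with player set `N`. Nature may take part as an additional
player, without preferences; a game without nature is one where nature has a single action. -/
structure NormalFormGame (N : Type u) where
  Act : Option N → Type v
  act_finite : ∀ j, Finite (Act j)
  act_nonempty : ∀ j, Nonempty (Act j)
  util : N → ((j : Option N) → Act j) → ℝ

namespace NormalFormGame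

variable {N : Type u} (Γ : NormalFormGame.{u, v} N)

/-- A belief of player `i` over the actions of the others. -/
abbrev Belief (i : N) := PMF (OppProfile Γ.Act i)

noncomputable def expectedUtil (i : N) (x : Γ.Act (some i)) (β : Γ.Belief i) : ℝ :=
  expectation β fun t => Γ.util i (joinProfile i x t)

/-- `x` maximizes the expected utility of player `i` given the belief `β`. -/
def Rational (i : N) (x : Γ.Act (some i)) (β : Γ.Belief i) : Prop :=
  ∀ y, Γ.expectedUtil i y β ≤ Γ.expectedUtil i x β

/-- The sets `Lⱼᵏ(β¹)` of level-`k` thinking actions, for `k ≥ 1` (the value at `k = 0` is a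
dummy). Nature is indifferent between all outcomes, so that all of its actions qualify. -/
def level (β₁ : (i : N) → Γ.Belief i) : ℕ → (j : Option N) → Set (Γ.Act j)
  | 0, _ => Set.univ
  | _ + 1, none => Set.univ
  | 1, some i => {x | Γ.Rational i x (β₁ i)}
  | k + 2, some i =>
      {x | ∃ β : Γ.Belief i,
        CertainOf β (oppSet (fun j => level β₁ (k + 1) j) i) ∧ Γ.Rational i x β}

end NormalFormGame

/-! ### Games in extensive form -/

/-- An action profile: `a j = some x` if `j` moves and plays `x`, `a j = none` if `j` does not
move. -/
abbrev ActionProfile (N : Type u) (A : Type v) := Option N → Option A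

/-- A history is a finite sequence of action profiles, listed from the most recent one to the
oldest one. Thus `a :: h` is the history `h` followed by `a`, and the subhistories (initial
segments) of `h` are the list suffixes of `h`. -/
abbrev History (N : Type u) (A : Type v) := List (ActionProfile N A)

/-- `h` belongs to `H` and has a successor in `H`. -/
def NonterminalIn {N : Type u} {A : Type v} (H : Set (History N A)) (h : History N A) : Prop :=
  h ∈ H ∧ ∃ a, a :: h ∈ H

/-- `h` belongs to `H` and has no successor in `H`. -/
def TerminalIn {N : Type u} {A : Type v} (H : Set (History N A)) (h : History N A) : Prop :=
  h ∈ H ∧ ¬ ∃ a, a :: h ∈ H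

/-- A finite game in extensive form with player set `N`, possibly with imperfect information,
simultaneous moves and moves of nature. -/
structure ExtensiveGame (N : Type u) (A : Type v) where
  /-- the set of histories -/
  H : Set (History N A)
  finite_H : H.Finite
  nil_mem : [] ∈ H
  mem_of_cons_mem : ∀ a h, a :: h ∈ H → h ∈ H
  /-- the players (possibly including nature) who move at a nonterminal history -/
  P : History N A → Set (Option N)
  P_nonempty : ∀ h, NonterminalIn H h → (P h).Nonempty
  /-- the actions available to those who move at a nonterminal history -/
  avail : Option N → History N A → Set A
  avail_nonempty : ∀ h, NonterminalIn H h → ∀ j ∈ P h, (avail j h).Nonempty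
  /-- the successors of a nonterminal history are given by the available action profiles -/
  cons_mem_iff : ∀ h, NonterminalIn H h → ∀ a, a :: h ∈ H ↔
    ∀ j, (j ∈ P h → ∃ x ∈ avail j h, a j = some x) ∧ (j ∉ P h → a j = none)
  /-- the information sets of a player: a partition of the nonterminal histories at which she
  moves, with the same actions available throughout an information set -/
  info : N → Set (Set (History N A))
  info_nonempty : ∀ i, ∀ I ∈ info i, I.Nonempty
  info_subset : ∀ i, ∀ I ∈ info i, ∀ h ∈ I, NonterminalIn H h ∧ some i ∈ P h
  info_cover : ∀ i h, NonterminalIn H h → some i ∈ P h → ∃! I, I ∈ info i ∧ h ∈ I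
  avail_eq : ∀ i, ∀ I ∈ info i, ∀ h ∈ I, ∀ h' ∈ I, avail (some i) h = avail (some i) h'
  /-- the Bernoulli utility indices on terminal histories -/
  util : N → {z // TerminalIn H z} → ℝ

namespace ExtensiveGame

variable {N : Type u} {A : Type v} (G : ExtensiveGame N A)

/-- Terminal histories. -/
abbrev Terminal := {z // TerminalIn G.H z}

/-- The information sets of a player or of nature; those of nature are singletons. -/
def infoSets : Option N → Set (Set (History N A))
  | some i => G.info i
  | none => {I | ∃ h, NonterminalIn G.H h ∧ none ∈ G.P h ∧ I = {h}}

/-- The information set of `j` that contains `h` (the empty set if there is none). -/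
def cell (j : Option N) (h : History N A) : Set (History N A) :=
  {h' | ∃ I ∈ G.infoSets j, h ∈ I ∧ h' ∈ I}

/-- The actions available to `j` at the information set `I`. -/
def availAt (j : Option N) (I : Set (History N A)) : Set A :=
  {x | ∃ h ∈ I, x ∈ G.avail j h}

/-- The experience of player `i` along a history: the information sets of `i` through which it
passes, with the actions that `i` takes there, in their order (most recent first). -/
def experience (i : N) : History N A → List (Set (History N A) × A)
  | [] => []
  | a :: h =>
    match a (some i) with
    | none => experience i h
    | some x => (G.cell (some i) h, x) :: experience i h

/-- Perfect recall: two histories in the same information set of a player give this player the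
same experience. -/
def PerfectRecall : Prop :=
  ∀ i : N, ∀ I ∈ G.info i, ∀ h ∈ I, ∀ h' ∈ I, G.experience i h = G.experience i h'

/-- The strategies of `j`: an available action for every information set. -/
abbrev Strategy (j : Option N) : Type (max u v) :=
  (I : {I // I ∈ G.infoSets j}) → {x // x ∈ G.availAt j I.1}

/-- Strategy profiles (including nature's strategy). -/
abbrev Profile : Type (max u v) := (j : Option N) → G.Strategy j

/-- Profiles of strategies of everybody but player `i`. -/
abbrev Opp (i : N) : Type (max u v) := OppProfile G.Strategy i

open Classical in
/-- The action profile that the strategy profile `s` prescribes at `h`. -/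
noncomputable def prescribed (s : G.Profile) (h : History N A) : ActionProfile N A :=
  fun j => if hj : G.cell j h ∈ G.infoSets j then some (s j ⟨G.cell j h, hj⟩).1 else none

open Classical in
/-- The history that is reached by `s` after `n` moves, or earlier if play ends before. -/
noncomputable def path (s : G.Profile) : ℕ → History N A
  | 0 => []
  | n + 1 => if NonterminalIn G.H (path s n) then G.prescribed s (path s n) :: path s n
      else path s n

theorem infoSets_subset {j : Option N} {I : Set (History N A)} (hI : I ∈ G.infoSets j)
    {h : History N A} (hh : h ∈ I) : NonterminalIn G.H h ∧ j ∈ G.P h := by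
  cases j with
  | none =>
    obtain ⟨g, hg, hP, rfl⟩ := hI
    obtain rfl : h = g := hh
    exact ⟨hg, hP⟩
  | some i => exact G.info_subset i I hI h hh

theorem infoSets_nonempty {j : Option N} {I : Set (History N A)} (hI : I ∈ G.infoSets j) :
    I.Nonempty := by
  cases j with
  | none =>
    obtain ⟨g, hg, hP, rfl⟩ := hI
    exact ⟨g, rfl⟩
  | some i => exact G.info_nonempty i I hI

theorem infoSets_avail {j : Option N} {I : Set (History N A)} (hI : I ∈ G.infoSets j)
    {h : History N A} (hh : h ∈ I) : G.availAt j I = G.avail j h := by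
  ext x
  refine ⟨?_, fun hx => ⟨h, hh, hx⟩⟩
  rintro ⟨h', hh', hx⟩
  cases j with
  | none =>
    obtain ⟨g, hg, hP, rfl⟩ := hI
    obtain rfl : h = g := hh
    obtain rfl : h' = h := hh'
    exact hx
  | some i => rwa [G.avail_eq i I hI h hh h' hh']

theorem cell_eq {j : Option N} {I : Set (History N A)} (hI : I ∈ G.infoSets j)
    {h : History N A} (hh : h ∈ I) : G.cell j h = I := by
  ext h'
  refine ⟨?_, fun hx => ⟨I, hI, hh, hx⟩⟩
  rintro ⟨J, hJ, hhJ, hx⟩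
  suffices I = J by rwa [this]
  cases j with
  | none =>
    obtain ⟨g, hg, hP, rfl⟩ := hI
    obtain ⟨g', hg', hP', rfl⟩ := hJ
    obtain rfl : h = g := hh
    obtain rfl : h = g' := hhJ
    rfl
  | some i =>
    obtain ⟨hn, hP⟩ := G.info_subset i I hI h hh
    exact (G.info_cover i h hn hP).unique ⟨hI, hh⟩ ⟨hJ, hhJ⟩

theorem exists_infoSet {j : Option N} {h : History N A} (hn : NonterminalIn G.H h)
    (hP : j ∈ G.P h) : ∃ I ∈ G.infoSets j, h ∈ I := by
  cases j with
  | none => exact ⟨{h}, ⟨h, hn, hP, rfl⟩, rfl⟩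
  | some i =>
    obtain ⟨I, ⟨hI, hh⟩, -⟩ := G.info_cover i h hn hP
    exact ⟨I, hI, hh⟩

theorem cons_prescribed_mem (s : G.Profile) {h : History N A} (hn : NonterminalIn G.H h) :
    G.prescribed s h :: h ∈ G.H := by
  rw [G.cons_mem_iff h hn]
  intro j
  constructor
  · intro hP
    obtain ⟨I, hI, hh⟩ := G.exists_infoSet hn hP
    have hc : G.cell j h ∈ G.infoSets j := by rwa [G.cell_eq hI hh]
    have hm : h ∈ G.cell j h := ⟨I, hI, hh, hh⟩
    refine ⟨(s j ⟨G.cell j h, hc⟩).1, ?_, ?_⟩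
    · rw [← G.infoSets_avail hc hm]
      exact (s j ⟨G.cell j h, hc⟩).2
    · simp [prescribed, hc]
  · intro hP
    have hc : G.cell j h ∉ G.infoSets j := by
      intro hc
      obtain ⟨h', I, hI, hh, -⟩ := G.infoSets_nonempty hc
      exact hP (G.infoSets_subset hI hh).2
    simp [prescribed, hc]

theorem path_mem (s : G.Profile) (n : ℕ) : G.path s n ∈ G.H := by
  induction n with
  | zero => exact G.nil_mem
  | succ n ih =>
    rw [path]
    split_ifs with hn
    · exact G.cons_prescribed_mem s hn
    · exact ih

theorem path_terminal_or_length (s : G.Profile) (n : ℕ) :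
    TerminalIn G.H (G.path s n) ∨ ∀ m ≤ n, (G.path s m).length = m := by
  induction n with
  | zero =>
    right
    intro m hm
    obtain rfl : m = 0 := by omega
    rfl
  | succ n ih =>
    by_cases hn : NonterminalIn G.H (G.path s n)
    · right
      intro m hm
      have ih' := ih.resolve_left fun h => h.2 hn.2
      rcases Nat.lt_or_ge m (n + 1) with h | h
      · exact ih' m (by omega)
      · obtain rfl : m = n + 1 := by omega
        rw [path, if_pos hn, List.length_cons, ih' n le_rfl]
    · left
      rw [path, if_neg hn]
      exact ⟨G.path_mem s n, fun h => hn ⟨G.path_mem s n, h⟩⟩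

theorem path_terminal (s : G.Profile) : TerminalIn G.H (G.path s G.H.ncard) := by
  refine (G.path_terminal_or_length s _).resolve_right fun h => ?_
  have hinj : Set.InjOn (G.path s) (Set.Iic G.H.ncard) := by
    intro m hm n hn hmn
    rw [← h m hm, ← h n hn, hmn]
  have hle : (G.path s '' Set.Iic G.H.ncard).ncard ≤ G.H.ncard := by
    refine Set.ncard_le_ncard ?_ G.finite_H
    rintro _ ⟨m, -, rfl⟩
    exact G.path_mem s m
  rw [Set.InjOn.ncard_image hinj] at hle
  rw [← Finset.coe_Iic, Set.ncard_coe_finset, Nat.card_Iic] at hle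
  omega

/-- The terminal history `z(s)` reached by the strategy profile `s`. -/
noncomputable def outcome (s : G.Profile) : G.Terminal :=
  ⟨G.path s G.H.ncard, G.path_terminal s⟩

/-- The set `Z(S')` of terminal histories reached by strategy profiles in `S'`. -/
def outcomes (S' : Set G.Profile) : Set G.Terminal :=
  {z | ∃ s ∈ S', z = G.outcome s}

/-- The strategy profile `s` reaches the set `I` of histories. -/
def Reaches (s : G.Profile) (I : Set (History N A)) : Prop :=
  ∃ h ∈ I, h <:+ (G.outcome s).1

/-- The strategy `sᵢ` of player `i` reaches `I`. -/
def OwnReaches (i : N) (x : G.Strategy (some i)) (I : Set (History N A)) : Prop :=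
  ∃ t : G.Opp i, G.Reaches (joinProfile i x t) I

/-- The profiles `s₋ᵢ` of strategies of the others that reach `I`. -/
def oppReaching (i : N) (I : Set (History N A)) : Set (G.Opp i) :=
  {t | ∃ x : G.Strategy (some i), G.Reaches (joinProfile i x t) I}

/-- `I` strictly precedes `J`: some history in `I` is a proper subhistory of one in `J`. -/
def Precedes (I J : Set (History N A)) : Prop :=
  ∃ h ∈ I, ∃ h' ∈ J, h <:+ h' ∧ h ≠ h'

/-- Belief systems of player `i`. -/
structure BeliefSystem (i : N) where
  belief : {I // I ∈ G.info i} → PMF (G.Opp i)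
  reaches : ∀ I, CertainOf (belief I) (G.oppReaching i I.1)
  conditioning : ∀ I J, Precedes I.1 J.1 →
    DerivedByConditioning (belief I) (belief J) (G.oppReaching i J.1)

/-- A belief system has full support if at every information set it gives positive probability
to each profile of strategies of the others that reaches this information set. -/
def BeliefSystem.FullSupport {G : ExtensiveGame N A} {i : N} (b : G.BeliefSystem i) : Prop :=
  ∀ I, (b.belief I).support = G.oppReaching i I.1

noncomputable def expectedUtil (i : N) (x : G.Strategy (some i)) (β : PMF (G.Opp i)) : ℝ :=
  expectation β fun t => G.util i (G.outcome (joinProfile i x t))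

/-- `y` is an `I`-replacement of `x`: they agree on all information sets strictly preceding
`I`. -/
def IsReplacement (i : N) (I : Set (History N A)) (x y : G.Strategy (some i)) : Prop :=
  ∀ J : {J // J ∈ G.info i}, Precedes J.1 I → y J = x J

/-- The strategy `x` is rational for player `i` at the information set `I` with the belief
system `b`. -/
def RationalAt (i : N) (x : G.Strategy (some i)) (b : G.BeliefSystem i)
    (I : {I // I ∈ G.info i}) : Prop :=
  ¬ G.OwnReaches i x I.1 ∨
    ¬ ∃ y, G.IsReplacement i I.1 x y ∧
      G.expectedUtil i x (b.belief I) < G.expectedUtil i y (b.belief I)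

/-- The belief systems of player `i` that assign at each information set the highest possible
level below `k` to the others, where `L ℓ` are the strong level-`ℓ` strategies for
`1 ≤ ℓ < k`, and that coincide with the first-level beliefs where no level is possible. For
`k = 1` there is no such `ℓ`, and the only element is the first-level belief system `b₁`. -/
def strongBeliefs (i : N) (b₁ : G.BeliefSystem i) (k : ℕ)
    (L : (ℓ : ℕ) → ℓ < k → (j : Option N) → Set (G.Strategy j)) : Set (G.BeliefSystem i) :=
  {b | ∀ I : {I // I ∈ G.info i},
    (∀ (ℓ : ℕ) (hℓ : ℓ < k),
      IsGreatest {m | 1 ≤ m ∧ ∃ hm : m < k, ∃ t ∈ oppSet (L m hm) i, t ∈ G.oppReaching i I.1} ℓ →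
        CertainOf (b.belief I) (oppSet (L ℓ hℓ) i)) ∧
    ((¬ ∃ m, 1 ≤ m ∧ ∃ hm : m < k, ∃ t ∈ oppSet (L m hm) i, t ∈ G.oppReaching i I.1) →
      b.belief I = b₁.belief I)}

/-- The sets of strong level-`k` thinking strategies, for `k ≥ 1` (the value at `k = 0` is a
dummy). Nature is indifferent between all outcomes, so that all of its strategies qualify. -/
def strongLevel (b₁ : (i : N) → G.BeliefSystem i) (k : ℕ) : (j : Option N) → Set (G.Strategy j)
  | none => Set.univ
  | some i =>
      {x | ∃ b ∈ G.strongBeliefs i (b₁ i) k (fun ℓ _ j => strongLevel b₁ ℓ j),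
        ∀ I, G.RationalAt i x b I}
termination_by k

/-! ### The associated normal form -/

theorem finite_availAt {j : Option N} {I : Set (History N A)} (hI : I ∈ G.infoSets j) :
    (G.availAt j I).Finite := by
  classical
  obtain ⟨h, hh⟩ := G.infoSets_nonempty hI
  obtain ⟨hn, hP⟩ := G.infoSets_subset hI hh
  rw [G.infoSets_avail hI hh]
  obtain ⟨a, ha⟩ := hn.2
  refine Set.Finite.of_injOn (f := fun x => Function.update a j (some x) :: h) (t := G.H)
    ?_ ?_ G.finite_H
  · intro x hx
    rw [G.cons_mem_iff h hn] at ha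
    refine (G.cons_mem_iff h hn _).2 fun j' => ?_
    by_cases hj : j' = j
    · subst hj
      exact ⟨fun _ => ⟨x, hx, by simp⟩, fun h' => absurd hP h'⟩
    · simpa [Function.update_of_ne hj] using ha j'
  · intro x _ y _ hxy
    have := congrFun (List.cons.inj hxy).1 j
    simpa using this

theorem finite_infoSets (j : Option N) : (G.infoSets j).Finite :=
  G.finite_H.finite_subsets.subset fun _ hI _ hh => (G.infoSets_subset hI hh).1.1

instance finite_strategy (j : Option N) : Finite (G.Strategy j) := by
  have := (G.finite_infoSets j).to_subtype
  have : ∀ I : {I // I ∈ G.infoSets j}, Finite {x // x ∈ G.availAt j I.1} :=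
    fun I => (G.finite_availAt I.2).to_subtype
  infer_instance

instance nonempty_strategy (j : Option N) : Nonempty (G.Strategy j) := by
  refine ⟨fun I => Classical.choice ?_⟩
  obtain ⟨h, hh⟩ := G.infoSets_nonempty I.2
  obtain ⟨hn, hP⟩ := G.infoSets_subset I.2 hh
  obtain ⟨x, hx⟩ := G.avail_nonempty h hn j hP
  exact ⟨x, h, hh, hx⟩

/-- The associated normal form: the actions are the strategies, and utilities are evaluated at
the terminal histories that are reached. -/
noncomputable def normalForm : NormalFormGame.{u, max u v} N where
  Act := G.Strategy
  act_finite := G.finite_strategy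
  act_nonempty := G.nonempty_strategy
  util i s := G.util i (G.outcome s)

/-- A belief in the associated normal form is consistent with a belief system if the latter
arises from the former by conditioning on the event that the information set is reached. -/
def Consistent {i : N} (b : G.BeliefSystem i) (β : G.normalForm.Belief i) : Prop :=
  ∀ I, DerivedByConditioning β (b.belief I) (G.oppReaching i I.1)

end ExtensiveGame

/-!
By perfect recall, a strategy profile reaches an information set `I` of player `i` as soon as `sᵢ`
and `s₋ᵢ` separately do. Hence changing `sᵢ` at and after `I` matters only against the profiles in
`S₋ᵢ(I)`, which has two consequences. First, optimizing at an information set that does not precede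
any of those treated before preserves rationality at the latter. So every belief system admits a
rational strategy, and all strong level-`k` sets are nonempty. Second, a profile `s₋ᵢ` against which
`i` moves at all reaches exactly one initial information set of `i`, whatever `i` does, and
rationality there is optimality among all strategies of `i`.

At level one, the payoff difference of two strategies is the sum of its restrictions to the
disjoint events `S₋ᵢ(I)`, `I` initial, and conditionally on each of them the rational strategy
is optimal. At level `k + 1`, take a profile `s₋ᵢ` of strong level-`k` strategies. If it reaches
an initial information set `I`, then `k` is the level attributed to the opponents there, and the
belief at `I` serves as a normal-form belief; otherwise `i` never moves against `s₋ᵢ`, and every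
strategy is optimal if `i` is certain of `s₋ᵢ`. Thus the inclusion holds for strategies and not
just for outcomes.
-/

theorem exists_cons_suffix {α : Type*} {g h : List α} (hs : g <:+ h) (hne : g ≠ h) :
    ∃ a, a :: g <:+ h := by
  obtain ⟨l, rfl⟩ := hs
  rcases List.eq_nil_or_concat l with rfl | ⟨l', a, rfl⟩
  · exact absurd rfl hne
  · exact ⟨a, l', by simp⟩

theorem ne_of_cons_suffix {α : Type*} {a : α} {g h : List α} (hs : a :: g <:+ h) : g ≠ h := by
  rintro rfl
  simpa using hs.length_le

section Expectation

variable {T : Type u} {p q r : PMF T} {E F : Set T}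

theorem certainOf_iff : CertainOf p E ↔ p.support ⊆ E :=
  p.toOuterMeasure_apply_eq_one_iff E

theorem certainOf_pure {t : T} (ht : t ∈ E) : CertainOf (PMF.pure t) E := by
  rwa [certainOf_iff, PMF.support_pure, Set.singleton_subset_iff]

theorem exists_pmf_support_eq [Finite T] (hE : E.Nonempty) : ∃ p : PMF T, p.support = E :=
  ⟨PMF.uniformOfFinset E.toFinite.toFinset (by simpa using hE), by simp⟩

theorem eq_filter_of_forall_eq_mul (hE : ∃ t ∈ E, t ∈ p.support) (c : ENNReal)
    (h : ∀ t, q t = E.indicator p t * c) : q = p.filter E hE := by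
  have hc : c * ∑' t, E.indicator p t = 1 := by
    rw [mul_comm, ← ENNReal.tsum_mul_right, ← q.tsum_coe]
    exact tsum_congr fun t => (h t).symm
  ext t
  rw [h, PMF.filter_apply, ENNReal.eq_inv_of_mul_eq_one_left hc]

theorem filter_filter_of_subset (hFE : F ⊆ E) (hE : ∃ t ∈ E, t ∈ p.support)
    (hF : ∃ t ∈ F, t ∈ p.support) (hF' : ∃ t ∈ F, t ∈ (p.filter E hE).support) :
    (p.filter E hE).filter F hF' = p.filter F hF := by
  refine eq_filter_of_forall_eq_mul hF
    ((∑' t, E.indicator p t)⁻¹ * (∑' t, F.indicator (p.filter E hE) t)⁻¹) fun t => ?_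
  by_cases ht : t ∈ F
  · simp only [PMF.filter_apply, Set.indicator_of_mem ht, Set.indicator_of_mem (hFE ht), mul_assoc]
  · simp only [PMF.filter_apply, Set.indicator_of_notMem ht, zero_mul]

theorem DerivedByConditioning.support_eq (hq : DerivedByConditioning p q E)
    (hE : ∃ t ∈ E, t ∈ p.support) : q.support = E ∩ p.support := by
  rw [hq hE, PMF.support_filter]

theorem DerivedByConditioning.of_subset (hq : DerivedByConditioning p q E)
    (hE : ∃ t ∈ E, t ∈ p.support) (hr : DerivedByConditioning p r F) (hFE : F ⊆ E) :
    DerivedByConditioning q r F := by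
  intro hF
  have hF' : ∃ t ∈ F, t ∈ p.support :=
    hF.imp fun t ht => ⟨ht.1, (hq.support_eq hE ▸ ht.2).2⟩
  obtain rfl := hq hE
  rw [hr hF', filter_filter_of_subset hFE]

theorem exists_derivedByConditioning (p : PMF T) (E : Set T) :
    ∃ q, DerivedByConditioning p q E := by
  by_cases hE : ∃ t ∈ E, t ∈ p.support
  · exact ⟨p.filter E hE, fun _ => rfl⟩
  · exact ⟨p, fun h => absurd h hE⟩

theorem expectation_pure (t : T) (f : T → ℝ) : expectation (PMF.pure t) f = f t := by
  rw [expectation, tsum_eq_single t fun t' ht' => by simp [PMF.pure_apply_of_ne _ _ ht']]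
  simp

theorem expectation_congr {f g : T → ℝ} (h : ∀ t ∈ p.support, f t = g t) :
    expectation p f = expectation p g := by
  refine tsum_congr fun t => ?_
  by_cases ht : t ∈ p.support
  · rw [h t ht]
  · simp [(p.apply_eq_zero_iff t).2 ht]

theorem expectation_sub [Finite T] (f g : T → ℝ) :
    expectation p (fun t => f t - g t) = expectation p f - expectation p g := by
  have := Fintype.ofFinite T
  simp [expectation, mul_sub]

theorem expectation_sum [Finite T] {ι : Type*} (s : Finset ι) (f : ι → T → ℝ) :
    expectation p (fun t => ∑ a ∈ s, f a t) = ∑ a ∈ s, expectation p (f a) := by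
  have := Fintype.ofFinite T
  simp only [expectation, tsum_fintype, Finset.mul_sum]
  exact Finset.sum_comm

theorem expectation_indicator (hE : ∃ t ∈ E, t ∈ p.support) (f : T → ℝ) :
    expectation p (E.indicator f) =
      (p.toOuterMeasure E).toReal * expectation (p.filter E hE) f := by
  have h0 : p.toOuterMeasure E ≠ 0 := by
    rw [Ne, PMF.toOuterMeasure_apply_eq_zero_iff]
    exact Set.not_disjoint_iff.2 (hE.imp fun t ht => ht.symm)
  have htop : p.toOuterMeasure E ≠ ⊤ := by
    rw [PMF.toOuterMeasure_apply]
    exact p.tsum_coe_indicator_ne_top E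
  have hpos := ENNReal.toReal_pos h0 htop
  rw [expectation, expectation, ← tsum_mul_left]
  refine tsum_congr fun t => ?_
  rw [PMF.filter_apply, ← PMF.toOuterMeasure_apply, ENNReal.toReal_mul, ENNReal.toReal_inv]
  by_cases ht : t ∈ E
  · rw [Set.indicator_of_mem ht, Set.indicator_of_mem ht]
    field_simp
  · simp [ht]

theorem DerivedByConditioning.expectation_indicator_nonneg (hq : DerivedByConditioning p q E)
    {f : T → ℝ} (hf : 0 ≤ expectation q f) : 0 ≤ expectation p (E.indicator f) := by
  by_cases hE : ∃ t ∈ E, t ∈ p.support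
  · rw [expectation_indicator hE, ← hq hE]
    exact mul_nonneg ENNReal.toReal_nonneg hf
  · have hzero : ∀ t ∈ p.support, E.indicator f t = 0 := fun t ht =>
      Set.indicator_of_notMem (fun htE => hE ⟨t, htE, ht⟩) f
    rw [expectation_congr hzero]
    simp [expectation]

end Expectation

section Profiles

variable {N : Type u} {S : Option N → Type v} {i : N}

theorem joinProfile_self (x : S (some i)) (t : OppProfile S i) :
    joinProfile i x t (some i) = x := by
  simp [joinProfile]

theorem joinProfile_of_ne (x : S (some i)) (t : OppProfile S i) {j : Option N}
    (hj : j ≠ some i) : joinProfile i x t j = t ⟨j, hj⟩ := by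
  simp [joinProfile, hj]

theorem joinProfile_right_injective (x : S (some i)) :
    Function.Injective (joinProfile (S := S) i x) := by
  intro t t' h
  funext j
  rw [← joinProfile_of_ne x t j.2, h, joinProfile_of_ne x t' j.2]

theorem oppSet_nonempty {L : (j : Option N) → Set (S j)} (hL : ∀ j, (L j).Nonempty) :
    (oppSet L i).Nonempty :=
  ⟨fun j => (hL j).some, fun j => (hL j).some_mem⟩

theorem oppSet_mono {L L' : (j : Option N) → Set (S j)} (hL : ∀ j, L j ⊆ L' j) :
    oppSet L i ⊆ oppSet L' i :=
  fun _ ht j => hL j (ht j)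

end Profiles

namespace ExtensiveGame

variable {N : Type u} {A : Type v} {G : ExtensiveGame N A} {i : N} {j : Option N}

/-! ### Play -/

theorem mem_of_suffix {g h : History N A} (hs : g <:+ h) (hh : h ∈ G.H) : g ∈ G.H := by
  induction h with
  | nil => rwa [List.suffix_nil.1 hs]
  | cons a h ih =>
    rcases List.suffix_cons_iff.1 hs with rfl | hs
    · exact hh
    · exact ih hs (G.mem_of_cons_mem a h hh)

theorem mem_H_of_mem_info {I : Set (History N A)} (hI : I ∈ G.info i) {h : History N A}
    (hh : h ∈ I) : h ∈ G.H :=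
  (G.info_subset i I hI h hh).1.1

theorem cell_eq_iff {I : Set (History N A)} (hI : I ∈ G.infoSets j) {h : History N A} :
    G.cell j h = I ↔ h ∈ I := by
  refine ⟨?_, G.cell_eq hI⟩
  rintro rfl
  obtain ⟨_, J, hJ, hh, -⟩ := G.infoSets_nonempty hI
  exact ⟨J, hJ, hh, hh⟩

theorem prescribed_eq_some (s : G.Profile) (I : {I // I ∈ G.infoSets j}) {h : History N A}
    (hh : h ∈ I.1) : G.prescribed s h j = some (s j I).1 := by
  obtain ⟨I, hI⟩ := I
  obtain rfl := G.cell_eq hI hh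
  simp [prescribed, hI]

theorem exists_eq_some {a : ActionProfile N A} {g : History N A} (ha : a :: g ∈ G.H)
    {I : Set (History N A)} (hI : I ∈ G.infoSets j) (hg : g ∈ I) : ∃ x, a j = some x := by
  obtain ⟨hn, hP⟩ := G.infoSets_subset hI hg
  obtain ⟨x, -, hx⟩ := ((G.cons_mem_iff g hn a).1 ha j).1 hP
  exact ⟨x, hx⟩

theorem eq_prescribed (s : G.Profile) {a : ActionProfile N A} {g : History N A}
    (ha : a :: g ∈ G.H)
    (h : ∀ j, ∀ I : {I // I ∈ G.infoSets j}, g ∈ I.1 → a j = some (s j I).1) :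
    a = G.prescribed s g := by
  have hn : NonterminalIn G.H g := ⟨G.mem_of_cons_mem a g ha, a, ha⟩
  funext j
  by_cases hP : j ∈ G.P g
  · obtain ⟨I, hI, hg⟩ := G.exists_infoSet hn hP
    rw [h j ⟨I, hI⟩ hg, prescribed_eq_some s ⟨I, hI⟩ hg]
  · rw [((G.cons_mem_iff g hn a).1 ha j).2 hP,
      ((G.cons_mem_iff g hn _).1 (G.cons_prescribed_mem s hn) j).2 hP]

theorem eq_prescribed_of_suffix_path (s : G.Profile) (n : ℕ) {a : ActionProfile N A}
    {g : History N A} (hs : a :: g <:+ G.path s n) : a = G.prescribed s g := by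
  induction n with
  | zero => simp [path] at hs
  | succ n ih =>
    rw [path] at hs
    split_ifs at hs
    · rcases List.suffix_cons_iff.1 hs with h | h
      · obtain ⟨rfl, rfl⟩ := List.cons.inj h
        rfl
      · exact ih h
    · exact ih hs

variable (G) in
/-- Along the history `h`, player `j` always takes the action that the strategy `σ` assigns to the
information set at hand. -/
def Follows (j : Option N) (σ : G.Strategy j) (h : History N A) : Prop :=
  ∀ a g, a :: g <:+ h → ∀ I : {I // I ∈ G.infoSets j}, g ∈ I.1 → a j = some (σ I).1

theorem Follows.congr {σ τ : G.Strategy j} {h : History N A} (hσ : G.Follows j σ h)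
    (hστ : ∀ I : {I // I ∈ G.infoSets j}, ∀ g ∈ I.1, g <:+ h → g ≠ h → τ I = σ I) :
    G.Follows j τ h := by
  intro a g hs I hg
  rw [hστ I g hg ((List.suffix_cons a g).trans hs) (ne_of_cons_suffix hs)]
  exact hσ a g hs I hg

theorem suffix_outcome_iff (s : G.Profile) {h : History N A} (hh : h ∈ G.H) :
    h <:+ (G.outcome s).1 ↔ ∀ j, G.Follows j (s j) h := by
  constructor
  · intro hs j a g hg I hgI
    rw [eq_prescribed_of_suffix_path s _ (hg.trans hs), prescribed_eq_some s I hgI]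
  · induction h with
    | nil => exact fun _ => List.nil_suffix
    | cons a h ih =>
      intro hf
      have hs : h <:+ (G.outcome s).1 := ih (G.mem_of_cons_mem a h hh) fun j b g hg =>
        hf j b g (hg.trans (List.suffix_cons a h))
      have hne : h ≠ (G.outcome s).1 := by
        rintro rfl
        exact (G.outcome s).2.2 ⟨a, hh⟩
      obtain ⟨b, hb⟩ := exists_cons_suffix hs hne
      rwa [eq_prescribed s hh fun j => hf j a h List.suffix_rfl,
        ← eq_prescribed_of_suffix_path s _ hb]

theorem outcome_eq_of_follows (s : G.Profile) (z : G.Terminal)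
    (h : ∀ j, G.Follows j (s j) z.1) : G.outcome s = z := by
  have hs := (suffix_outcome_iff s z.2.1).2 h
  by_contra hne
  obtain ⟨a, ha⟩ := exists_cons_suffix hs fun heq => hne (Subtype.ext heq.symm)
  exact z.2.2 ⟨a, mem_of_suffix ha (G.outcome s).2.1⟩

theorem forall_follows_joinProfile_iff {x : G.Strategy (some i)} {t : G.Opp i}
    {h : History N A} : (∀ j, G.Follows j (joinProfile i x t j) h) ↔
      G.Follows (some i) x h ∧ ∀ j : {j : Option N // j ≠ some i}, G.Follows j (t j) h := by
  constructor
  · intro hf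
    refine ⟨?_, fun j => ?_⟩
    · simpa only [joinProfile_self] using hf (some i)
    · simpa only [joinProfile_of_ne x t j.2] using hf j
  · rintro ⟨hx, ht⟩ j
    by_cases hj : j = some i
    · subst hj
      rwa [joinProfile_self]
    · rw [joinProfile_of_ne x t hj]
      exact ht ⟨j, hj⟩

theorem suffix_outcome_joinProfile_iff {x : G.Strategy (some i)} {t : G.Opp i}
    {h : History N A} (hh : h ∈ G.H) : h <:+ (G.outcome (joinProfile i x t)).1 ↔
      G.Follows (some i) x h ∧ ∀ j : {j : Option N // j ≠ some i}, G.Follows j (t j) h := by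
  rw [suffix_outcome_iff _ hh, forall_follows_joinProfile_iff]

theorem outcome_joinProfile_congr {x y : G.Strategy (some i)} {t : G.Opp i}
    (h : ∀ I : {I // I ∈ G.info i}, G.Reaches (joinProfile i x t) I.1 → y I = x I) :
    G.outcome (joinProfile i y t) = G.outcome (joinProfile i x t) := by
  obtain ⟨hx, ht⟩ := (suffix_outcome_joinProfile_iff
    (G.outcome (joinProfile i x t)).2.1).1 List.suffix_rfl
  refine outcome_eq_of_follows _ _ (forall_follows_joinProfile_iff.2 ⟨?_, ht⟩)
  exact hx.congr fun I g hg hs _ => h I ⟨g, hg, hs⟩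

instance finite_profile : Finite G.Profile := by
  -- `N` may be infinite, but a profile is determined by the moves it makes at the finitely many
  -- nonterminal histories.
  have hfin : {h | NonterminalIn G.H h}.Finite := G.finite_H.subset fun _ hh => hh.1
  have := hfin.to_subtype
  have := G.finite_H.to_subtype
  refine Finite.of_injective (β := {h | NonterminalIn G.H h} → G.H)
    (fun s h => ⟨G.prescribed s h :: h, G.cons_prescribed_mem s h.2⟩) fun s s' hss' => ?_
  funext j I
  obtain ⟨h, hh⟩ := G.infoSets_nonempty I.2
  have hcons := congrArg Subtype.val (congrFun hss' ⟨h, (G.infoSets_subset I.2 hh).1⟩)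
  have hmove := congrFun (List.cons.inj hcons).1 j
  rw [prescribed_eq_some s I hh, prescribed_eq_some s' I hh] at hmove
  exact Subtype.ext (Option.some.inj hmove)

instance finite_opp : Finite (G.Opp i) :=
  Finite.of_injective _ (joinProfile_right_injective (Classical.arbitrary (G.Strategy (some i))))

/-! ### Information sets under perfect recall -/

theorem Reaches.eq_or_precedes {s : G.Profile} {I J : Set (History N A)} (hI : I ∈ G.info i)
    (hJ : J ∈ G.info i) (hsI : G.Reaches s I) (hsJ : G.Reaches s J) :
    I = J ∨ Precedes I J ∨ Precedes J I := by
  obtain ⟨g, hg, hgs⟩ := hsI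
  obtain ⟨h, hh, hhs⟩ := hsJ
  by_cases hgh : g = h
  · subst hgh
    exact Or.inl ((G.cell_eq (j := some i) hI hg).symm.trans (G.cell_eq (j := some i) hJ hh))
  · rcases List.suffix_or_suffix_of_suffix hgs hhs with hs | hs
    · exact Or.inr (Or.inl ⟨g, hg, h, hh, hs, hgh⟩)
    · exact Or.inr (Or.inr ⟨h, hh, g, hg, hs, Ne.symm hgh⟩)

theorem IsReplacement.reaches {I : Set (History N A)} (hI : I ∈ G.info i)
    {x y : G.Strategy (some i)} (hxy : G.IsReplacement i I x y) {t : G.Opp i}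
    (hx : G.Reaches (joinProfile i x t) I) : G.Reaches (joinProfile i y t) I := by
  obtain ⟨h, hh, hs⟩ := hx
  have hH := mem_H_of_mem_info hI hh
  obtain ⟨hfx, ht⟩ := (suffix_outcome_joinProfile_iff hH).1 hs
  refine ⟨h, hh, (suffix_outcome_joinProfile_iff hH).2 ⟨?_, ht⟩⟩
  exact hfx.congr fun J g hg hgh hne => hxy J ⟨g, hg, h, hh, hgh, hne⟩

theorem IsReplacement.ownReaches {I : Set (History N A)} (hI : I ∈ G.info i)
    {x y : G.Strategy (some i)} (hxy : G.IsReplacement i I x y) (hx : G.OwnReaches i x I) :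
    G.OwnReaches i y I :=
  hx.imp fun _ => hxy.reaches hI

theorem cons_experience_suffix {a : ActionProfile N A} {g h : History N A} (hs : a :: g <:+ h)
    {x : A} (ha : a (some i) = some x) :
    (G.cell (some i) g, x) :: G.experience i g <:+ G.experience i h := by
  induction h with
  | nil => simp at hs
  | cons b h ih =>
    rcases List.suffix_cons_iff.1 hs with heq | hs
    · obtain ⟨rfl, rfl⟩ := List.cons.inj heq
      simp [experience, ha]
    · rw [experience]
      split
      · exact ih hs
      · exact (ih hs).trans (List.suffix_cons _ _)

theorem mem_experience_iff {I : Set (History N A)} (hI : I ∈ G.info i) {h : History N A} {x : A} :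
    (I, x) ∈ G.experience i h ↔ ∃ a g, a :: g <:+ h ∧ g ∈ I ∧ a (some i) = some x := by
  constructor
  · induction h with
    | nil => simp [experience]
    | cons b h ih =>
      have hlift (hmem : (I, x) ∈ G.experience i h) :
          ∃ a g, a :: g <:+ b :: h ∧ g ∈ I ∧ a (some i) = some x := by
        obtain ⟨a, g, hs, hag⟩ := ih hmem
        exact ⟨a, g, hs.trans (List.suffix_cons b h), hag⟩
      rw [experience]
      split
      · exact hlift
      · next y hb =>
        rw [List.mem_cons, Prod.mk.injEq]
        rintro (⟨hcell, rfl⟩ | hmem)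
        · exact ⟨b, h, List.suffix_rfl, (cell_eq_iff (j := some i) hI).1 hcell.symm, hb⟩
        · exact hlift hmem
  · rintro ⟨a, g, hs, hg, ha⟩
    rw [← G.cell_eq (j := some i) hI hg]
    exact (cons_experience_suffix hs ha).subset List.mem_cons_self

theorem follows_iff_experience {x : G.Strategy (some i)} {h : History N A} (hh : h ∈ G.H) :
    G.Follows (some i) x h ↔
      ∀ I : {I // I ∈ G.info i}, ∀ a, (I.1, a) ∈ G.experience i h → (x I).1 = a := by
  constructor
  · intro hf I b hb
    obtain ⟨a, g, hs, hg, ha⟩ := (mem_experience_iff I.2).1 hb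
    exact Option.some.inj ((hf a g hs I hg).symm.trans ha)
  · intro he a g hs I hg
    obtain ⟨b, hb⟩ := exists_eq_some (mem_of_suffix hs hh) I.2 hg
    rw [hb, he I b ((mem_experience_iff I.2).2 ⟨a, g, hs, hg, hb⟩)]

theorem PerfectRecall.reaches_joinProfile_iff (hG : G.PerfectRecall) {I : Set (History N A)}
    (hI : I ∈ G.info i) {x : G.Strategy (some i)} {t : G.Opp i} :
    G.Reaches (joinProfile i x t) I ↔ G.OwnReaches i x I ∧ t ∈ G.oppReaching i I := by
  refine ⟨fun h => ⟨⟨t, h⟩, x, h⟩, ?_⟩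
  rintro ⟨⟨t', g, hg, hgs⟩, x', h, hh, hhs⟩
  have hgH := mem_H_of_mem_info hI hg
  have hhH := mem_H_of_mem_info hI hh
  obtain ⟨hx, -⟩ := (suffix_outcome_joinProfile_iff hgH).1 hgs
  obtain ⟨-, ht⟩ := (suffix_outcome_joinProfile_iff hhH).1 hhs
  refine ⟨h, hh, (suffix_outcome_joinProfile_iff hhH).2 ⟨?_, ht⟩⟩
  rwa [follows_iff_experience hhH, ← hG i I hI g hg h hh, ← follows_iff_experience hgH]

theorem PerfectRecall.exists_suffix_of_precedes (hG : G.PerfectRecall) {I J : Set (History N A)}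
    (hI : I ∈ G.info i) (hJ : J ∈ G.info i) (hIJ : Precedes I J) {h : History N A} (hh : h ∈ J) :
    ∃ a g, a :: g <:+ h ∧ g ∈ I ∧ ∃ x, a (some i) = some x := by
  obtain ⟨g, hg, g', hg', hs, hne⟩ := hIJ
  obtain ⟨a, ha⟩ := exists_cons_suffix hs hne
  obtain ⟨x, hx⟩ := exists_eq_some (j := some i)
    (mem_of_suffix ha (mem_H_of_mem_info hJ hg')) hI hg
  have hmem : (I, x) ∈ G.experience i h := by
    rw [hG i J hJ h hh g' hg', mem_experience_iff hI]
    exact ⟨a, g, ha, hg, hx⟩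
  obtain ⟨b, f, hf, hfI, hb⟩ := (mem_experience_iff hI).1 hmem
  exact ⟨b, f, hf, hfI, x, hb⟩

theorem PerfectRecall.precedes_trans (hG : G.PerfectRecall) {I J K : Set (History N A)}
    (hI : I ∈ G.info i) (hJ : J ∈ G.info i) (hIJ : Precedes I J) (hJK : Precedes J K) :
    Precedes I K := by
  obtain ⟨h, hh, h', hh', hs, -⟩ := hJK
  obtain ⟨a, g, hag, hg, -⟩ := hG.exists_suffix_of_precedes hI hJ hIJ hh
  exact ⟨g, hg, h', hh', (List.suffix_cons a g).trans (hag.trans hs),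
    ne_of_cons_suffix (hag.trans hs)⟩

theorem PerfectRecall.oppReaching_anti (hG : G.PerfectRecall) {I J : Set (History N A)}
    (hI : I ∈ G.info i) (hJ : J ∈ G.info i) (hIJ : Precedes I J) :
    G.oppReaching i J ⊆ G.oppReaching i I := by
  rintro t ⟨x, h, hh, hs⟩
  obtain ⟨a, g, hag, hg, -⟩ := hG.exists_suffix_of_precedes hI hJ hIJ hh
  exact ⟨x, g, hg, (List.suffix_cons a g).trans (hag.trans hs)⟩

/-- The number of moves that `i` has made before the information set `I`, read off an arbitrary
history in `I`: under perfect recall the choice does not matter. -/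
noncomputable def depth (I : {I // I ∈ G.info i}) : ℕ :=
  (G.experience i (G.info_nonempty i I.1 I.2).some).length

theorem PerfectRecall.depth_eq (hG : G.PerfectRecall) (I : {I // I ∈ G.info i}) {h : History N A}
    (hh : h ∈ I.1) : depth I = (G.experience i h).length := by
  rw [depth, hG i I.1 I.2 _ (G.info_nonempty i I.1 I.2).some_mem h hh]

theorem PerfectRecall.depth_lt (hG : G.PerfectRecall) {I J : {I // I ∈ G.info i}}
    (hIJ : Precedes I.1 J.1) : depth I < depth J := by
  obtain ⟨h, hh⟩ := G.info_nonempty i J.1 J.2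
  obtain ⟨a, g, hs, hg, x, hx⟩ := hG.exists_suffix_of_precedes I.2 J.2 hIJ hh
  rw [hG.depth_eq I hg, hG.depth_eq J hh]
  exact (cons_experience_suffix hs hx).length_le

/-! ### Deviations -/

variable (G) in
/-- The utility of player `i` from playing the strategy `x` against the profile `t` of strategies
of the others. -/
noncomputable def payoff (i : N) (x : G.Strategy (some i)) (t : G.Opp i) : ℝ :=
  G.util i (G.outcome (joinProfile i x t))

theorem expectedUtil_eq_expectation_payoff (x : G.Strategy (some i)) (p : PMF (G.Opp i)) :
    G.expectedUtil i x p = expectation p (G.payoff i x) :=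
  rfl

open Classical in
/-- The strategy that coincides with `y` at and after the information set `I`, and with `x`
elsewhere. -/
noncomputable def deviateFrom (I : Set (History N A)) (x y : G.Strategy (some i)) :
    G.Strategy (some i) :=
  fun J => if J.1 = I ∨ Precedes I J.1 then y J else x J

theorem PerfectRecall.isReplacement_deviateFrom (hG : G.PerfectRecall) {I : Set (History N A)}
    (hI : I ∈ G.info i) (x y : G.Strategy (some i)) :
    G.IsReplacement i I x (deviateFrom I x y) := fun J hJI => if_neg <| by
  have hlt : depth J < depth ⟨I, hI⟩ := hG.depth_lt hJI
  rintro (heq | hIJ)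
  · exact hlt.ne (congrArg depth (Subtype.ext heq))
  · exact hlt.not_gt (hG.depth_lt hIJ)

theorem PerfectRecall.outcome_deviateFrom_of_mem (hG : G.PerfectRecall) {I : Set (History N A)}
    (hI : I ∈ G.info i) {x y : G.Strategy (some i)} (hx : G.OwnReaches i x I)
    (hxy : G.IsReplacement i I x y) {t : G.Opp i} (ht : t ∈ G.oppReaching i I) :
    G.outcome (joinProfile i (deviateFrom I x y) t) = G.outcome (joinProfile i y t) := by
  have hreach : G.Reaches (joinProfile i y t) I :=
    (hG.reaches_joinProfile_iff hI).2 ⟨hxy.ownReaches hI hx, ht⟩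
  refine outcome_joinProfile_congr fun J hJ => ?_
  rcases hreach.eq_or_precedes hI J.2 hJ with heq | hIJ | hJI
  · exact if_pos (Or.inl heq.symm)
  · exact if_pos (Or.inr hIJ)
  · exact (hG.isReplacement_deviateFrom hI x y J hJI).trans (hxy J hJI).symm

theorem PerfectRecall.outcome_deviateFrom_of_notMem (hG : G.PerfectRecall)
    {I : Set (History N A)} (hI : I ∈ G.info i) (x y : G.Strategy (some i)) {t : G.Opp i}
    (ht : t ∉ G.oppReaching i I) :
    G.outcome (joinProfile i (deviateFrom I x y) t) = G.outcome (joinProfile i x t) := by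
  refine outcome_joinProfile_congr fun J hJ => if_neg ?_
  rintro (heq | hIJ)
  · exact ht (heq ▸ ⟨x, hJ⟩)
  · exact ht (hG.oppReaching_anti hI J.2 hIJ ⟨x, hJ⟩)

theorem PerfectRecall.expectedUtil_deviateFrom_sub (hG : G.PerfectRecall)
    {I : Set (History N A)} (hI : I ∈ G.info i) {x y : G.Strategy (some i)}
    (hx : G.OwnReaches i x I) (hxy : G.IsReplacement i I x y) (p : PMF (G.Opp i)) :
    G.expectedUtil i (deviateFrom I x y) p - G.expectedUtil i x p =
      expectation p ((G.oppReaching i I).indicator fun t => G.payoff i y t - G.payoff i x t) := by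
  rw [expectedUtil_eq_expectation_payoff, expectedUtil_eq_expectation_payoff, ← expectation_sub]
  refine expectation_congr fun t _ => ?_
  by_cases ht : t ∈ G.oppReaching i I
  · rw [Set.indicator_of_mem ht, payoff, hG.outcome_deviateFrom_of_mem hI hx hxy ht, payoff, payoff]
  · rw [Set.indicator_of_notMem ht, payoff, hG.outcome_deviateFrom_of_notMem hI x y ht, payoff,
      sub_self]

theorem PerfectRecall.expectedUtil_le_deviateFrom (hG : G.PerfectRecall) {I : Set (History N A)}
    (hI : I ∈ G.info i) {x y : G.Strategy (some i)} (hx : G.OwnReaches i x I)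
    (hxy : G.IsReplacement i I x y) {p q : PMF (G.Opp i)}
    (hpq : DerivedByConditioning p q (G.oppReaching i I))
    (hle : G.expectedUtil i x q ≤ G.expectedUtil i y q) :
    G.expectedUtil i x p ≤ G.expectedUtil i (deviateFrom I x y) p := by
  rw [← sub_nonneg, hG.expectedUtil_deviateFrom_sub hI hx hxy]
  refine hpq.expectation_indicator_nonneg ?_
  rw [expectation_sub]
  exact sub_nonneg.2 hle

/-! ### Existence of rational strategies -/

theorem BeliefSystem.support_subset (b : G.BeliefSystem i) (I : {I // I ∈ G.info i}) :
    (b.belief I).support ⊆ G.oppReaching i I.1 :=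
  certainOf_iff.1 (b.reaches I)

theorem rationalAt_iff {x : G.Strategy (some i)} {b : G.BeliefSystem i}
    {I : {I // I ∈ G.info i}} : G.RationalAt i x b I ↔ (G.OwnReaches i x I.1 →
      ∀ y, G.IsReplacement i I.1 x y →
        G.expectedUtil i y (b.belief I) ≤ G.expectedUtil i x (b.belief I)) := by
  simp only [RationalAt, ← imp_iff_not_or, not_exists, not_and, not_lt]

theorem PerfectRecall.rationalAt_deviateFrom_self (hG : G.PerfectRecall) {b : G.BeliefSystem i}
    {I : {I // I ∈ G.info i}} {x y : G.Strategy (some i)} (hx : G.OwnReaches i x I.1)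
    (hxy : G.IsReplacement i I.1 x y)
    (hy : ∀ z, G.IsReplacement i I.1 x z →
      G.expectedUtil i z (b.belief I) ≤ G.expectedUtil i y (b.belief I)) :
    G.RationalAt i (deviateFrom I.1 x y) b I := by
  have hdev : G.expectedUtil i (deviateFrom I.1 x y) (b.belief I) =
      G.expectedUtil i y (b.belief I) := expectation_congr fun t ht => by
    rw [hG.outcome_deviateFrom_of_mem I.2 hx hxy (b.support_subset I ht)]
  refine rationalAt_iff.2 fun _ z hz => ?_
  rw [hdev]
  exact hy z fun J hJI => (hz J hJI).trans (hG.isReplacement_deviateFrom I.2 x y J hJI)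

theorem PerfectRecall.rationalAt_deviateFrom_of_not_precedes (hG : G.PerfectRecall)
    {b : G.BeliefSystem i} {I J : {I // I ∈ G.info i}} {x y : G.Strategy (some i)}
    (hx : G.OwnReaches i x I.1) (hxy : G.IsReplacement i I.1 x y)
    (hle : G.expectedUtil i x (b.belief I) ≤ G.expectedUtil i y (b.belief I))
    (hne : I ≠ J) (hIJ : ¬ Precedes I.1 J.1) (hJ : G.RationalAt i x b J) :
    G.RationalAt i (deviateFrom I.1 x y) b J := by
  have hbefore : ∀ K : {K // K ∈ G.info i}, Precedes K.1 J.1 →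
      deviateFrom I.1 x y K = x K := fun K hKJ => if_neg <| by
    rintro (heq | hIK)
    · exact hIJ (heq ▸ hKJ)
    · exact hIJ (hG.precedes_trans I.2 K.2 hIK hKJ)
  refine rationalAt_iff.2 fun hreach z hz => ?_
  have hxJ : G.OwnReaches i x J.1 :=
    IsReplacement.ownReaches J.2 (fun K hKJ => (hbefore K hKJ).symm) hreach
  have hxz : G.expectedUtil i z (b.belief J) ≤ G.expectedUtil i x (b.belief J) :=
    rationalAt_iff.1 hJ hxJ z fun K hKJ => (hz K hKJ).trans (hbefore K hKJ)
  have hcond : DerivedByConditioning (b.belief J) (b.belief I) (G.oppReaching i I.1) := by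
    rintro ⟨t, htI, ht⟩
    have hreachI := (hG.reaches_joinProfile_iff I.2).2 ⟨hx, htI⟩
    have hreachJ := (hG.reaches_joinProfile_iff J.2).2 ⟨hxJ, b.support_subset J ht⟩
    have hJI : Precedes J.1 I.1 := ((hreachI.eq_or_precedes I.2 J.2 hreachJ).resolve_left
      fun heq => hne (Subtype.ext heq)).resolve_left hIJ
    exact b.conditioning J I hJI ⟨t, htI, ht⟩
  exact hxz.trans (hG.expectedUtil_le_deviateFrom I.2 hx hxy hcond hle)

theorem PerfectRecall.exists_rationalAt (hG : G.PerfectRecall) (b : G.BeliefSystem i) :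
    ∃ x, ∀ I, G.RationalAt i x b I := by
  classical
  have : Finite {I // I ∈ G.info i} := (G.finite_infoSets (some i)).to_subtype
  have := Fintype.ofFinite {I // I ∈ G.info i}
  suffices h : ∀ s : Finset {I // I ∈ G.info i}, ∃ x, ∀ I ∈ s, G.RationalAt i x b I by
    obtain ⟨x, hx⟩ := h Finset.univ
    exact ⟨x, fun I => hx I (Finset.mem_univ I)⟩
  intro s
  induction s using Finset.induction_on_max_value depth with
  | empty => exact ⟨Classical.arbitrary _, by simp⟩
  | insert I s hIs hmax ih =>
    obtain ⟨x, hx⟩ := ih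
    by_cases hreach : G.OwnReaches i x I.1
    · obtain ⟨y, hxy, hy⟩ := Set.exists_max_image {y | G.IsReplacement i I.1 x y}
        (fun y => G.expectedUtil i y (b.belief I)) (Set.toFinite _) ⟨x, fun _ _ => rfl⟩
      refine ⟨deviateFrom I.1 x y, (Finset.forall_mem_insert _ _ _).2
        ⟨hG.rationalAt_deviateFrom_self hreach hxy hy, fun J hJ => ?_⟩⟩
      exact hG.rationalAt_deviateFrom_of_not_precedes hreach hxy (hy x fun _ _ => rfl)
        (ne_of_mem_of_not_mem hJ hIs).symm
        (fun hIJ => (hmax J hJ).not_gt (hG.depth_lt hIJ)) (hx J hJ)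
    · exact ⟨x, (Finset.forall_mem_insert _ _ _).2 ⟨Or.inl hreach, hx⟩⟩

/-! ### Existence of strong level-`k` strategies -/

variable (G) in
/-- The levels below `k` that opponents who reach the information set `I` of `i` may have, where
`L ℓ` are the level-`ℓ` strategies. The greatest element is the level attributed to them at `I` in
`strongBeliefs`; the condition `m < k` is an existential in order to match the set that occurs
there. -/
def levelsReaching (i : N) (k : ℕ) (L : ℕ → (j : Option N) → Set (G.Strategy j))
    (I : Set (History N A)) : Set ℕ :=
  {m | 1 ≤ m ∧ ∃ _ : m < k, ∃ t ∈ oppSet (L m) i, t ∈ G.oppReaching i I}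

theorem exists_isGreatest_levelsReaching {k : ℕ} {L : ℕ → (j : Option N) → Set (G.Strategy j)}
    {I : Set (History N A)} (h : (G.levelsReaching i k L I).Nonempty) :
    ∃ ℓ, IsGreatest (G.levelsReaching i k L I) ℓ := by
  obtain ⟨ℓ, hℓ, hmax⟩ := Set.exists_max_image _ id
    ((Set.finite_lt_nat k).subset fun m (hm : m ∈ G.levelsReaching i k L I) => hm.2.1) h
  exact ⟨ℓ, hℓ, hmax⟩

theorem PerfectRecall.levelsReaching_anti (hG : G.PerfectRecall) (k : ℕ)
    (L : ℕ → (j : Option N) → Set (G.Strategy j)) {I J : Set (History N A)}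
    (hI : I ∈ G.info i) (hJ : J ∈ G.info i) (hIJ : Precedes I J) :
    G.levelsReaching i k L J ⊆ G.levelsReaching i k L I :=
  fun _ ⟨h1, hk, t, ht, htJ⟩ => ⟨h1, hk, t, ht, hG.oppReaching_anti hI hJ hIJ htJ⟩

section LevelBeliefs

variable {b₁ : G.BeliefSystem i} {k : ℕ} {L : ℕ → (j : Option N) → Set (G.Strategy j)}
  {μ : ℕ → PMF (G.Opp i)}

variable (G) in
/-- `q` is a belief at the information set `I` of the kind required by `strongBeliefs`, obtained
from the priors `μ ℓ` over the level-`ℓ` opponents. Since these priors do not depend on `I`, such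
beliefs at different information sets fit together to a belief system. -/
def IsLevelBelief (i : N) (b₁ : G.BeliefSystem i) (k : ℕ)
    (L : ℕ → (j : Option N) → Set (G.Strategy j)) (μ : ℕ → PMF (G.Opp i))
    (I : {I // I ∈ G.info i}) (q : PMF (G.Opp i)) : Prop :=
  (∀ ℓ, IsGreatest (G.levelsReaching i k L I.1) ℓ →
    DerivedByConditioning (μ ℓ) q (G.oppReaching i I.1)) ∧
  (¬ (G.levelsReaching i k L I.1).Nonempty → q = b₁.belief I)

variable (b₁ k L μ) in
theorem exists_isLevelBelief (I : {I // I ∈ G.info i}) : ∃ q, G.IsLevelBelief i b₁ k L μ I q := by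
  by_cases hne : (G.levelsReaching i k L I.1).Nonempty
  · obtain ⟨ℓ, hℓ⟩ := exists_isGreatest_levelsReaching hne
    obtain ⟨q, hq⟩ := exists_derivedByConditioning (μ ℓ) (G.oppReaching i I.1)
    exact ⟨q, fun m hm => hm.unique hℓ ▸ hq, fun h => absurd hne h⟩
  · exact ⟨b₁.belief I, fun ℓ hℓ => absurd ⟨ℓ, hℓ.1⟩ hne, fun _ => rfl⟩

theorem IsLevelBelief.support_eq (hμ : ∀ ℓ, (oppSet (L ℓ) i).Nonempty →
      (μ ℓ).support = oppSet (L ℓ) i) {I : {I // I ∈ G.info i}} {q : PMF (G.Opp i)}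
    (hq : G.IsLevelBelief i b₁ k L μ I q) {ℓ : ℕ}
    (hℓ : IsGreatest (G.levelsReaching i k L I.1) ℓ) :
    q.support = G.oppReaching i I.1 ∩ oppSet (L ℓ) i := by
  obtain ⟨-, -, t, ht, htI⟩ := hℓ.1
  have hsupp := hμ ℓ ⟨t, ht⟩
  rw [(hq.1 ℓ hℓ).support_eq ⟨t, htI, hsupp ▸ ht⟩, hsupp]

theorem IsLevelBelief.support_subset (hμ : ∀ ℓ, (oppSet (L ℓ) i).Nonempty →
      (μ ℓ).support = oppSet (L ℓ) i) {I : {I // I ∈ G.info i}} {q : PMF (G.Opp i)}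
    (hq : G.IsLevelBelief i b₁ k L μ I q) : q.support ⊆ G.oppReaching i I.1 := by
  by_cases hne : (G.levelsReaching i k L I.1).Nonempty
  · obtain ⟨ℓ, hℓ⟩ := exists_isGreatest_levelsReaching hne
    exact (hq.support_eq hμ hℓ).subset.trans Set.inter_subset_left
  · exact hq.2 hne ▸ b₁.support_subset I

theorem PerfectRecall.derivedByConditioning_of_isLevelBelief (hG : G.PerfectRecall)
    (hμ : ∀ ℓ, (oppSet (L ℓ) i).Nonempty → (μ ℓ).support = oppSet (L ℓ) i)
    {I J : {I // I ∈ G.info i}} (hIJ : Precedes I.1 J.1) {q r : PMF (G.Opp i)}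
    (hq : G.IsLevelBelief i b₁ k L μ I q) (hr : G.IsLevelBelief i b₁ k L μ J r) :
    DerivedByConditioning q r (G.oppReaching i J.1) := by
  have hanti := hG.levelsReaching_anti k L I.2 J.2 hIJ
  by_cases hne : (G.levelsReaching i k L I.1).Nonempty
  · obtain ⟨ℓ, hℓ⟩ := exists_isGreatest_levelsReaching hne
    obtain ⟨h1, hk, t, ht, htI⟩ := hℓ.1
    rintro ⟨t', ht'J, ht'⟩
    have ht'ℓ : t' ∈ oppSet (L ℓ) i := (hq.support_eq hμ hℓ ▸ ht').2
    have hℓJ : IsGreatest (G.levelsReaching i k L J.1) ℓ :=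
      ⟨⟨h1, hk, t', ht'ℓ, ht'J⟩, fun m hm => hℓ.2 (hanti hm)⟩
    exact (hq.1 ℓ hℓ).of_subset ⟨t, htI, (hμ ℓ ⟨t, ht⟩).symm ▸ ht⟩ (hr.1 ℓ hℓJ)
      (hG.oppReaching_anti I.2 J.2 hIJ) ⟨t', ht'J, ht'⟩
  · rw [hq.2 hne, hr.2 fun h => hne (h.mono hanti)]
    exact b₁.conditioning I J hIJ

theorem PerfectRecall.strongBeliefs_nonempty (hG : G.PerfectRecall) (b₁ : G.BeliefSystem i)
    (k : ℕ) (L : ℕ → (j : Option N) → Set (G.Strategy j)) :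
    (G.strongBeliefs i b₁ k fun ℓ _ => L ℓ).Nonempty := by
  have hprior (ℓ : ℕ) : ∃ p : PMF (G.Opp i), (oppSet (L ℓ) i).Nonempty →
      p.support = oppSet (L ℓ) i := by
    by_cases hne : (oppSet (L ℓ) i).Nonempty
    · exact (exists_pmf_support_eq hne).imp fun _ hp _ => hp
    · exact ⟨PMF.pure (Classical.arbitrary _), fun h => absurd h hne⟩
  choose μ hμ using hprior
  choose q hq using exists_isLevelBelief b₁ k L μ
  refine ⟨⟨q, fun I => certainOf_iff.2 ((hq I).support_subset hμ), fun I J hIJ =>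
    hG.derivedByConditioning_of_isLevelBelief hμ hIJ (hq I) (hq J)⟩, fun I => ⟨?_, (hq I).2⟩⟩
  intro ℓ _ hℓ
  exact certainOf_iff.2 (((hq I).support_eq hμ hℓ).subset.trans Set.inter_subset_right)

end LevelBeliefs

theorem mem_strongLevel_some_iff {b₁ : (i : N) → G.BeliefSystem i} {k : ℕ}
    {x : G.Strategy (some i)} : x ∈ G.strongLevel b₁ k (some i) ↔
      ∃ b ∈ G.strongBeliefs i (b₁ i) k (fun ℓ _ => G.strongLevel b₁ ℓ),
        ∀ I, G.RationalAt i x b I := by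
  rw [strongLevel]
  rfl

theorem PerfectRecall.strongLevel_nonempty (hG : G.PerfectRecall)
    (b₁ : (i : N) → G.BeliefSystem i) (k : ℕ) (j : Option N) :
    (G.strongLevel b₁ k j).Nonempty := by
  cases j with
  | none =>
    rw [strongLevel]
    exact Set.univ_nonempty
  | some i =>
    obtain ⟨b, hb⟩ := hG.strongBeliefs_nonempty (b₁ i) k (G.strongLevel b₁)
    obtain ⟨x, hx⟩ := hG.exists_rationalAt b
    exact ⟨x, mem_strongLevel_some_iff.2 ⟨b, hb, hx⟩⟩

/-! ### Initial information sets -/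

/-- The information set `I` of player `i` is initial: no information set of `i` strictly precedes
it. -/
def IsInitial (I : {I // I ∈ G.info i}) : Prop :=
  ∀ J ∈ G.info i, ¬ Precedes J I.1

theorem IsInitial.isReplacement {I : {I // I ∈ G.info i}} (hI : IsInitial I)
    (x y : G.Strategy (some i)) : G.IsReplacement i I.1 x y :=
  fun J hJI => absurd hJI (hI J.1 J.2)

theorem IsInitial.reaches_of_mem_oppReaching {I : {I // I ∈ G.info i}} (hI : IsInitial I)
    {t : G.Opp i} (ht : t ∈ G.oppReaching i I.1) (x : G.Strategy (some i)) :
    G.Reaches (joinProfile i x t) I.1 := by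
  obtain ⟨y, hy⟩ := ht
  exact (hI.isReplacement y x).reaches I.2 hy

theorem IsInitial.eq_of_mem_oppReaching {I J : {I // I ∈ G.info i}} (hI : IsInitial I)
    (hJ : IsInitial J) {t : G.Opp i} (htI : t ∈ G.oppReaching i I.1)
    (htJ : t ∈ G.oppReaching i J.1) : I = J := by
  let x : G.Strategy (some i) := Classical.arbitrary _
  rcases (hI.reaches_of_mem_oppReaching htI x).eq_or_precedes I.2 J.2
    (hJ.reaches_of_mem_oppReaching htJ x) with heq | hIJ | hJI
  · exact Subtype.ext heq
  · exact absurd hIJ (hJ I.1 I.2)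
  · exact absurd hJI (hI J.1 J.2)

theorem IsInitial.expectedUtil_le {I : {I // I ∈ G.info i}} (hI : IsInitial I)
    {b : G.BeliefSystem i} {x : G.Strategy (some i)} (hx : G.RationalAt i x b I)
    (y : G.Strategy (some i)) :
    G.expectedUtil i y (b.belief I) ≤ G.expectedUtil i x (b.belief I) := by
  obtain ⟨t, ht⟩ := (b.belief I).support_nonempty
  exact rationalAt_iff.1 hx ⟨t, hI.reaches_of_mem_oppReaching (b.support_subset I ht) x⟩ y
    (hI.isReplacement x y)

theorem PerfectRecall.exists_isInitial (hG : G.PerfectRecall) {J : {I // I ∈ G.info i}}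
    {t : G.Opp i} (ht : t ∈ G.oppReaching i J.1) :
    ∃ I : {I // I ∈ G.info i}, IsInitial I ∧ t ∈ G.oppReaching i I.1 := by
  induction hd : depth J using Nat.strong_induction_on generalizing J with
  | _ d ih =>
    by_cases hJ : IsInitial J
    · exact ⟨J, hJ, ht⟩
    · simp only [IsInitial, not_forall, not_not] at hJ
      obtain ⟨K, hK, hKJ⟩ := hJ
      exact ih _ (hd ▸ hG.depth_lt (I := ⟨K, hK⟩) hKJ) (hG.oppReaching_anti hK J.2 hKJ ht) rfl

theorem PerfectRecall.payoff_congr (hG : G.PerfectRecall) {t : G.Opp i}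
    (ht : ∀ I : {I // I ∈ G.info i}, IsInitial I → t ∉ G.oppReaching i I.1)
    (x y : G.Strategy (some i)) : G.payoff i y t = G.payoff i x t := by
  refine congrArg (G.util i) (outcome_joinProfile_congr fun J hJ => ?_)
  obtain ⟨I, hI, htI⟩ := hG.exists_isInitial ⟨x, hJ⟩
  exact absurd htI (ht I hI)

open Classical in
theorem PerfectRecall.payoff_sub_eq_sum (hG : G.PerfectRecall) [Fintype {I // I ∈ G.info i}]
    (x y : G.Strategy (some i)) (t : G.Opp i) :
    G.payoff i x t - G.payoff i y t = ∑ I : {I // I ∈ G.info i} with IsInitial I,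
      (G.oppReaching i I.1).indicator (fun t' => G.payoff i x t' - G.payoff i y t') t := by
  by_cases ht : ∃ I : {I // I ∈ G.info i}, IsInitial I ∧ t ∈ G.oppReaching i I.1
  · obtain ⟨I, hI, htI⟩ := ht
    rw [Finset.sum_eq_single_of_mem I (Finset.mem_filter_univ I |>.2 hI),
      Set.indicator_of_mem htI]
    intro J hJ hJI
    refine Set.indicator_of_notMem (fun htJ => hJI ?_) _
    exact ((Finset.mem_filter_univ J).1 hJ).eq_of_mem_oppReaching hI htJ htI
  · have hnone : ∀ I : {I // I ∈ G.info i}, IsInitial I → t ∉ G.oppReaching i I.1 :=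
      fun I hI htI => ht ⟨I, hI, htI⟩
    rw [hG.payoff_congr hnone y x, sub_self]
    refine (Finset.sum_eq_zero fun I hI => Set.indicator_of_notMem ?_ _).symm
    exact hnone I ((Finset.mem_filter_univ I).1 hI)

/-! ### Comparison with normal-form level-`k` thinking -/

theorem PerfectRecall.expectedUtil_le_of_forall_isInitial (hG : G.PerfectRecall)
    {b : G.BeliefSystem i} {p : PMF (G.Opp i)}
    (hp : ∀ I, IsInitial I → DerivedByConditioning p (b.belief I) (G.oppReaching i I.1))
    {x : G.Strategy (some i)} (hx : ∀ I, IsInitial I → G.RationalAt i x b I)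
    (y : G.Strategy (some i)) : G.expectedUtil i y p ≤ G.expectedUtil i x p := by
  classical
  have : Finite {I // I ∈ G.info i} := (G.finite_infoSets (some i)).to_subtype
  have := Fintype.ofFinite {I // I ∈ G.info i}
  rw [← sub_nonneg, expectedUtil_eq_expectation_payoff, expectedUtil_eq_expectation_payoff,
    ← expectation_sub, expectation_congr fun t _ => hG.payoff_sub_eq_sum x y t, expectation_sum]
  refine Finset.sum_nonneg fun I hI => ?_
  have hI : IsInitial I := (Finset.mem_filter_univ I).1 hI
  refine (hp I hI).expectation_indicator_nonneg ?_
  rw [expectation_sub]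
  exact sub_nonneg.2 (hI.expectedUtil_le (hx I hI) y)

theorem belief_eq_of_mem_strongBeliefs_one {b b₁ : G.BeliefSystem i}
    {L : ℕ → (j : Option N) → Set (G.Strategy j)}
    (hb : b ∈ G.strongBeliefs i b₁ 1 fun ℓ _ => L ℓ) : b.belief = b₁.belief := by
  funext I
  refine (hb I).2 ?_
  rintro ⟨m, h1, h2, -⟩
  omega

theorem PerfectRecall.strongLevel_one_subset (hG : G.PerfectRecall)
    {b₁ : (i : N) → G.BeliefSystem i} {β₁ : (i : N) → G.normalForm.Belief i}
    (hcons : G.Consistent (b₁ i) (β₁ i)) :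
    G.strongLevel b₁ 1 (some i) ⊆ {x | G.normalForm.Rational i x (β₁ i)} := by
  intro x hx
  obtain ⟨b, hb, hrat⟩ := mem_strongLevel_some_iff.1 hx
  refine hG.expectedUtil_le_of_forall_isInitial (fun I _ => ?_) fun I _ => hrat I
  rw [belief_eq_of_mem_strongBeliefs_one hb]
  exact hcons I

theorem PerfectRecall.exists_certainOf_rational (hG : G.PerfectRecall)
    {b₁ : (i : N) → G.BeliefSystem i} {k : ℕ} (hk : 1 ≤ k) {x : G.Strategy (some i)}
    (hx : x ∈ G.strongLevel b₁ (k + 1) (some i)) :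
    ∃ β : G.normalForm.Belief i,
      CertainOf β (oppSet (G.strongLevel b₁ k) i) ∧ G.normalForm.Rational i x β := by
  obtain ⟨b, hb, hrat⟩ := mem_strongLevel_some_iff.1 hx
  obtain ⟨t, ht⟩ := oppSet_nonempty (i := i) fun j => hG.strongLevel_nonempty b₁ k j
  by_cases h : ∃ I : {I // I ∈ G.info i}, IsInitial I ∧ t ∈ G.oppReaching i I.1
  · obtain ⟨I, hI, htI⟩ := h
    refine ⟨b.belief I, (hb I).1 k k.lt_succ_self ?_, hI.expectedUtil_le (hrat I)⟩
    exact ⟨⟨hk, k.lt_succ_self, t, ht, htI⟩, fun m hm => Nat.lt_succ_iff.1 hm.2.1⟩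
  · refine ⟨PMF.pure t, certainOf_pure ht, fun y => le_of_eq ?_⟩
    have hpayoff : G.payoff i y t = G.payoff i x t :=
      hG.payoff_congr (fun I hI htI => h ⟨I, hI, htI⟩) x y
    exact (expectation_pure t _).trans (hpayoff.trans (expectation_pure t _).symm)

end ExtensiveGame

theorem mainTheorem1_general {N : Type u} {A : Type v} (G : ExtensiveGame N A)
    (hG : G.PerfectRecall) (b₁ : (i : N) → G.BeliefSystem i)
    (β₁ : (i : N) → G.normalForm.Belief i) (hcons : ∀ i, G.Consistent (b₁ i) (β₁ i))
    (k : ℕ) (hk : 1 ≤ k) (j : Option N) :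
    G.strongLevel b₁ k j ⊆ G.normalForm.level β₁ k j := by
  induction k, hk using Nat.le_induction generalizing j with
  | base =>
    cases j with
    | none => exact Set.subset_univ _
    | some i => exact hG.strongLevel_one_subset (hcons i)
  | succ k hk ih =>
    obtain ⟨k, rfl⟩ := Nat.exists_eq_add_of_le' hk
    cases j with
    | none => exact Set.subset_univ _
    | some i =>
      intro x hx
      obtain ⟨β, hβ, hrat⟩ := hG.exists_certainOf_rational hk hx
      exact ⟨β, certainOf_iff.2 ((certainOf_iff.1 hβ).trans (oppSet_mono ih)), hrat⟩

theorem mainTheorem1 {N : Type u} {A : Type v} [Finite N] [Nonempty N] (G : ExtensiveGame N A)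
    (hG : G.PerfectRecall)
    (b₁ : (i : N) → G.BeliefSystem i) (hb₁ : ∀ i, (b₁ i).FullSupport)
    (β₁ : (i : N) → G.normalForm.Belief i) (hβ₁ : ∀ i, (β₁ i).support = Set.univ)
    (hcons : ∀ i, G.Consistent (b₁ i) (β₁ i)) (k : ℕ) (hk : 1 ≤ k) :
    G.outcomes {s | ∀ j, s j ∈ G.strongLevel b₁ k j} ⊆
      G.outcomes {s | ∀ j, s j ∈ G.normalForm.level β₁ k j} :=
  fun _ ⟨s, hs, hz⟩ => ⟨s, fun j => mainTheorem1_general G hG b₁ β₁ hcons k hk j (hs j), hz⟩
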